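/- Let $D_r=\{z\in\mathbb C:|z|\le r\}$ and let $f:D_1\to\mathbb C$ be analytic on a neighbourhood of $D_1$, with Taylor expansion $f(z)=\sum_{k\ge 0}a_kz^k$ at $0$. Suppose that all $a_k$ are rational; let $p_k>0$ be the denominator of $a_k$ in lowest terms and $h_l=\max\{p_k: 1\le k\le l\}$, and suppose that there is a polynomial $S$ with $h_l\le e^{S(l)}$ for all $l\ge 1$. For $d\ge 1$ and $z$ near $0$ let $a_i^j(z)=\frac{1}{i!}(f^j)^{(i)}(z)$ be the $i$-th Taylor coefficient of $f^j$ at $z$, and let the Bautin determinant $\Delta_d(z)$ be the determinant of the $(d^2+d)\times(d^2+d)$ matrix with rows $i=d+1,\dots,d^2+2d$, columns $(j,k)$, $1\le j\le d$, $0\le k\le d$ (both in lexicographic order), and entries $a^j_{i-k}(z)$. Let the Bautin multiplicity $\eta_d$ be the order of vanishing of $\Delta_d(z)$ at $z=0$. Suppose that no $\Delta_d$, $d\ge 1$, vanishes identically near $0$, and that there is a polynomial $R$ with $\eta_d\le R(d)$ for all $d\ge 1$. Let $\nu_d$ be the maximal order of vanishing at $0$ of $P(z,f(z))$ over non-zero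 $P\in\mathbb C[X,Y]$ of total degree at most $d$, and let $\mathcal Z_d(f)$ be the maximal number of zeros in $D_{1/4}$, counted with multiplicity, of $\sum_{j=0}^d p_j(z)f(z)^j$, over all $p_0,\dots,p_d\in\mathbb C[z]$ of degree at most $d$ that are not all zero. Then $$\eta_d\ \ge\ \nu_d-d^2-2d\qquad(d\ge 1),$$ and there is a polynomial $T$ such that $\mathcal Z_d(f)$ is finite and $\mathcal Z_d(f)\le T(d)$ for all $d\ge 1$. -/

import Mathlib

open scoped BigOperators

noncomputable section

namespace BautinBezout

/-- The `i`-th Taylor coefficient of `g` at the point `z`. -/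
def taylorCoeff (g : ℂ → ℂ) (i : ℕ) (z : ℂ) : ℂ :=
  iteratedDeriv i g z / (i.factorial : ℂ)

/-- The square matrix `M̃(z)` of size `d² + d` attached to the family `∑ p_j f^j`, `deg p_j ≤ d`,
with Taylor expansions taken at `z`. Writing `a_i^j(z)` for the `i`-th Taylor coefficient of `f^j`
at `z`, its rows are numbered by `i = d+1, …, d²+2d`, its columns by the pairs `(j, k)` with
`1 ≤ j ≤ d` and `0 ≤ k ≤ d`, and the entry in row `i` and column `(j, k)` is `a_{i-k}^j(z)`.
The row number `i` is written as `i = (d+1) (r.1 + 1) + r.2` with `r.1 < d` and `r.2 ≤ d`, and the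
column `(j, k)` as `(c.1 + 1, c.2)`. -/
def bautinMatrix (f : ℂ → ℂ) (d : ℕ) (z : ℂ) :
    Matrix (Fin d × Fin (d + 1)) (Fin d × Fin (d + 1)) ℂ :=
  Matrix.of fun r c =>
    taylorCoeff (fun w => f w ^ ((c.1 : ℕ) + 1))
      ((d + 1) * ((r.1 : ℕ) + 1) + (r.2 : ℕ) - (c.2 : ℕ)) z

/-- The Bautin determinant `Δ_d(z)`. -/
def bautinDet (f : ℂ → ℂ) (d : ℕ) (z : ℂ) : ℂ :=
  (bautinMatrix f d z).det

/-- The Bautin multiplicity `η_d`: the order of vanishing at `0` of `z ↦ Δ_d(z)`. It is `⊤` exactly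
when `Δ_d` vanishes identically near `0`. -/
def bautinMultiplicity (f : ℂ → ℂ) (d : ℕ) : ℕ∞ :=
  analyticOrderAt (bautinDet f d) 0

/-- The transcendence index `ν_d`: the maximal order of vanishing at `0` of `P(z, f(z))` over the
non-zero polynomials `P` in two variables of total degree at most `d`. -/
def transcendenceIndex (f : ℂ → ℂ) (d : ℕ) : ℕ∞ :=
  ⨆ (P : MvPolynomial (Fin 2) ℂ) (_ : P ≠ 0) (_ : P.totalDegree ≤ d),
    analyticOrderAt (fun z : ℂ => MvPolynomial.eval ![z, f z] P) 0

/-- The number of zeros of `g` in the set `D`, counted with multiplicity (`⊤` if infinite). -/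
def zeroCount (g : ℂ → ℂ) (D : Set ℂ) : ℕ∞ :=
  ⨆ (s : Finset ℂ) (_ : (s : Set ℂ) ⊆ D), ∑ z ∈ s, analyticOrderAt g z

/-- `𝒵_d(f)` on the closed disc of radius `r`: the maximal number of zeros in this disc, counted
with multiplicity, of `∑_{j=0}^d p_j(z) f(z)^j`, over all families of polynomials `p_0, …, p_d` of
degree at most `d` that are not all zero. -/
def maxZeros (f : ℂ → ℂ) (r : ℝ) (d : ℕ) : ℕ∞ :=
  ⨆ (p : Fin (d + 1) → Polynomial ℂ) (_ : p ≠ 0) (_ : ∀ j, (p j).natDegree ≤ d),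
    zeroCount (fun z : ℂ => ∑ j, (p j).eval z * f z ^ (j : ℕ)) (Metric.closedBall 0 r)

/-- `h_l`: the maximum of the denominators (in lowest terms) of `a_1, …, a_l`. -/
def denomHeight (a : ℕ → ℚ) (l : ℕ) : ℕ :=
  (Finset.Icc 1 l).sup fun k => (a k).den

end BautinBezout

end

noncomputable section

namespace BautinBezout

/-! ### Taylor coefficients as functions of the base point -/

section TaylorCoeff

variable {F G : ℂ → ℂ} {z : ℂ}

/-! Write `P = ∑ p_j f^j`. At every base point `z` near `0`, the Bautin matrix sends the Taylor
coefficients of `p_1, …, p_d` to those of `P` with index `d+1, …, d²+2d`; `p_0` drops out by degree.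
Multiplying by the adjugate gives `Δ_d(z) c(z) = ∑ adj(z) · (Taylor coefficients of P at z)` for
each coefficient `c` (`bautinDet_mul_coeffVector`), and both conclusions come from reading this
identity in `z`.

Orders: if `P` vanishes at `0` to order `n + d² + 2d`, the right side vanishes to order `n`.
Choosing `c` with `c(0) ≠ 0` gives `η_d ≥ n` (`le_bautinMultiplicity`).

Zeros: `ν` zeros in the disc of radius `1/4` force `|P| ≤ ε` there, with `ε` proportional to
`(2/3)^ν μ`, where `μ` is the largest coefficient of the `p_j` (`norm_le_of_zeros`). A Cauchy
estimate for the `η_d`-th coefficient of the identity bounds the leading coefficient of `Δ_d` times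
`c(0)` by a constant times `ε`. That leading coefficient is a nonzero rational with controlled
denominator, so it is not too small (`one_le_norm_taylorCoeff_bautinDet`). Hence `μ` is at most a
constant times `ε`, and cancelling `μ` bounds `(3/2)^ν` (`pow_sum_le`). The logarithm of the bound
is polynomial in `d`. -/

theorem natCast_le_analyticOrderAt_iff_taylorCoeff (hF : AnalyticAt ℂ F z) {n : ℕ} :
    (n : ℕ∞) ≤ analyticOrderAt F z ↔ ∀ i < n, taylorCoeff F i z = 0 := by
  rw [natCast_le_analyticOrderAt_iff_iteratedDeriv_eq_zero hF]
  simp [taylorCoeff, Nat.factorial_ne_zero]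

theorem analyticOrderAt_le_of_taylorCoeff_ne_zero (hF : AnalyticAt ℂ F z) {n : ℕ}
    (h : taylorCoeff F n z ≠ 0) : analyticOrderAt F z ≤ n := by
  by_contra! hlt
  have h1 : ((n + 1 : ℕ) : ℕ∞) ≤ analyticOrderAt F z := by
    exact_mod_cast Order.add_one_le_of_lt hlt
  exact h ((natCast_le_analyticOrderAt_iff_taylorCoeff hF).1 h1 n n.lt_succ_self)

theorem taylorCoeff_ne_zero_of_analyticOrderAt_eq (hF : AnalyticAt ℂ F z) {n : ℕ}
    (h : analyticOrderAt F z = n) : taylorCoeff F n z ≠ 0 := by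
  intro h0
  have h1 : ((n + 1 : ℕ) : ℕ∞) ≤ analyticOrderAt F z := by
    rw [natCast_le_analyticOrderAt_iff_taylorCoeff hF]
    intro i hi
    rcases Nat.lt_succ_iff_lt_or_eq.1 hi with hi | rfl
    · exact (natCast_le_analyticOrderAt_iff_taylorCoeff hF).1 h.ge i hi
    · exact h0
  rw [h] at h1
  exact absurd (by exact_mod_cast h1) (Nat.not_succ_le_self n)

theorem analyticAt_taylorCoeff (hF : AnalyticAt ℂ F z) (m : ℕ) :
    AnalyticAt ℂ (fun w => taylorCoeff F m w) z := by
  have := hF.iterated_deriv m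
  simp only [← iteratedDeriv_eq_iterate] at this
  unfold taylorCoeff
  fun_prop (disch := exact_mod_cast m.factorial_ne_zero)

theorem taylorCoeff_mul (hF : AnalyticAt ℂ F z) (hG : AnalyticAt ℂ G z) (n : ℕ) :
    taylorCoeff (fun w => F w * G w) n z =
      ∑ i ∈ Finset.range (n + 1), taylorCoeff F i z * taylorCoeff G (n - i) z := by
  unfold taylorCoeff
  rw [iteratedDeriv_fun_mul hF.contDiffAt hG.contDiffAt, Finset.sum_div]
  refine Finset.sum_congr rfl fun i hi => ?_
  have hin : i ≤ n := by simpa [Nat.lt_succ_iff] using hi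
  have h1 : (n.factorial : ℂ) ≠ 0 := by exact_mod_cast n.factorial_ne_zero
  have h2 : (i.factorial : ℂ) ≠ 0 := by exact_mod_cast i.factorial_ne_zero
  have h3 : ((n - i).factorial : ℂ) ≠ 0 := by exact_mod_cast (n - i).factorial_ne_zero
  rw [Nat.cast_choose ℂ hin]
  field_simp

theorem taylorCoeff_sum {ι : Type*} (s : Finset ι) {F : ι → ℂ → ℂ}
    (hF : ∀ i ∈ s, AnalyticAt ℂ (F i) z) (n : ℕ) :
    taylorCoeff (fun w => ∑ i ∈ s, F i w) n z = ∑ i ∈ s, taylorCoeff (F i) n z := by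
  unfold taylorCoeff
  rw [iteratedDeriv_fun_sum fun i hi => (hF i hi).contDiffAt, Finset.sum_div]

theorem taylorCoeff_const_mul (c : ℂ) (F : ℂ → ℂ) (n : ℕ) :
    taylorCoeff (fun w => c * F w) n z = c * taylorCoeff F n z := by
  unfold taylorCoeff
  rw [iteratedDeriv_const_mul_field, mul_div_assoc]

/-- With the factorials divided out, re-expansion only costs an integer binomial factor, so it
introduces no new denominators. -/
theorem taylorCoeff_taylorCoeff (F : ℂ → ℂ) (m l : ℕ) (z : ℂ) :
    taylorCoeff (fun w => taylorCoeff F m w) l z =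
      ((m + l).choose l : ℂ) * taylorCoeff F (m + l) z := by
  unfold taylorCoeff
  rw [iteratedDeriv_div_const]
  have h : iteratedDeriv l (fun w => iteratedDeriv m F w) z = iteratedDeriv (m + l) F z := by
    simp only [iteratedDeriv_eq_iterate]
    rw [add_comm, Function.iterate_add_apply]
  have h1 : ((m + l).factorial : ℂ) ≠ 0 := by exact_mod_cast (m + l).factorial_ne_zero
  have h2 : (m.factorial : ℂ) ≠ 0 := by exact_mod_cast m.factorial_ne_zero
  have h3 : (l.factorial : ℂ) ≠ 0 := by exact_mod_cast l.factorial_ne_zero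
  rw [h, Nat.cast_choose ℂ (Nat.le_add_left l m), Nat.add_sub_cancel]
  field_simp

theorem taylorCoeff_polynomial (p : Polynomial ℂ) (k : ℕ) (z : ℂ) :
    taylorCoeff (fun w => p.eval w) k z = (Polynomial.hasseDeriv k p).eval z := by
  have h : ∀ (n : ℕ) (q : Polynomial ℂ),
      deriv^[n] (fun w => q.eval w) = fun w => (Polynomial.derivative^[n] q).eval w := by
    intro n
    induction n with
    | zero => intro q; rfl
    | succ n ih =>
      intro q
      rw [Function.iterate_succ_apply, Function.iterate_succ_apply, ← ih]
      congr 1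
      funext w
      exact q.deriv
  have h2 : (k.factorial : ℂ) ≠ 0 := by exact_mod_cast k.factorial_ne_zero
  unfold taylorCoeff
  rw [iteratedDeriv_eq_iterate, h, ← Polynomial.factorial_smul_hasseDeriv]
  simp [nsmul_eq_mul, h2]

theorem taylorCoeff_polynomial_zero (p : Polynomial ℂ) (k : ℕ) :
    taylorCoeff (fun w => p.eval w) k 0 = p.coeff k := by
  rw [taylorCoeff_polynomial, ← Polynomial.coeff_zero_eq_eval_zero, Polynomial.hasseDeriv_coeff]
  simp

theorem taylorCoeff_polynomial_eq_zero {p : Polynomial ℂ} {k : ℕ} (hk : p.natDegree < k) (z : ℂ) :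
    taylorCoeff (fun w => p.eval w) k z = 0 := by
  rw [taylorCoeff_polynomial, Polynomial.hasseDeriv_eq_zero_of_lt_natDegree p k hk]
  simp

theorem norm_taylorCoeff_le {r C : ℝ} (hr : 0 < r)
    (hF : ∀ w ∈ Metric.closedBall z r, AnalyticAt ℂ F w)
    (hC : ∀ w ∈ Metric.closedBall z r, ‖F w‖ ≤ C) (n : ℕ) :
    ‖taylorCoeff F n z‖ ≤ C / r ^ n := by
  have hd : DiffContOnCl ℂ F (Metric.ball z r) := by
    apply DifferentiableOn.diffContOnCl
    rw [closure_ball z hr.ne']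
    exact fun w hw => (hF w hw).differentiableAt.differentiableWithinAt
  have := Complex.norm_iteratedDeriv_le_of_forall_mem_sphere_norm_le n hr hd
    fun w hw => hC w (Metric.sphere_subset_closedBall hw)
  have h0 : (0 : ℝ) < n.factorial := by exact_mod_cast n.factorial_pos
  unfold taylorCoeff
  rw [norm_div, Complex.norm_natCast, div_le_iff₀ h0]
  calc _ ≤ _ := this
    _ = _ := by ring

/-- All other Leibniz terms contain a vanishing lower coefficient of `F`. This extracts the leading
coefficient of `Δ_d` from a product. -/
theorem taylorCoeff_mul_of_order {n : ℕ} (hF : AnalyticAt ℂ F z) (hG : AnalyticAt ℂ G z)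
    (h : (n : ℕ∞) ≤ analyticOrderAt F z) :
    taylorCoeff (fun w => F w * G w) n z = taylorCoeff F n z * G z := by
  rw [taylorCoeff_mul hF hG, Finset.sum_range_succ, Finset.sum_eq_zero]
  · simp [taylorCoeff]
  · intro i hi
    rw [(natCast_le_analyticOrderAt_iff_taylorCoeff hF).1 h i (Finset.mem_range.1 hi), zero_mul]

theorem le_analyticOrderAt_taylorCoeff {n i m : ℕ} (hF : AnalyticAt ℂ F z)
    (h : ((n + m : ℕ) : ℕ∞) ≤ analyticOrderAt F z) (hi : i ≤ m) :
    (n : ℕ∞) ≤ analyticOrderAt (fun w => taylorCoeff F i w) z := by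
  rw [natCast_le_analyticOrderAt_iff_taylorCoeff (analyticAt_taylorCoeff hF i)]
  intro l hl
  rw [taylorCoeff_taylorCoeff,
    (natCast_le_analyticOrderAt_iff_taylorCoeff hF).1 h (i + l) (by omega), mul_zero]

theorem le_analyticOrderAt_sum {ι : Type*} (s : Finset ι) {F : ι → ℂ → ℂ} {n : ℕ}
    (hF : ∀ i ∈ s, AnalyticAt ℂ (F i) z) (h : ∀ i ∈ s, (n : ℕ∞) ≤ analyticOrderAt (F i) z) :
    (n : ℕ∞) ≤ analyticOrderAt (fun w => ∑ i ∈ s, F i w) z := by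
  rw [natCast_le_analyticOrderAt_iff_taylorCoeff (Finset.analyticAt_fun_sum s hF)]
  intro l hl
  rw [taylorCoeff_sum s hF]
  exact Finset.sum_eq_zero fun i hi =>
    (natCast_le_analyticOrderAt_iff_taylorCoeff (hF i hi)).1 (h i hi) l hl

theorem analyticAt_det {ι : Type*} [Fintype ι] [DecidableEq ι] {A : ℂ → Matrix ι ι ℂ}
    (hA : ∀ i j, AnalyticAt ℂ (fun w => A w i j) z) : AnalyticAt ℂ (fun w => (A w).det) z := by
  simp only [Matrix.det_apply']
  refine Finset.analyticAt_fun_sum _ fun σ _ => ?_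
  exact analyticAt_const.mul (Finset.analyticAt_fun_prod _ fun i _ => hA _ _)

end TaylorCoeff

/-! ### Cramer's rule for the Bautin matrix and the bound on orders at the origin -/

section Cramer

variable {f : ℂ → ℂ} {d : ℕ} {z : ℂ}

/-- The function `∑ j, p_j f ^ j`. -/
def polyCombination (f : ℂ → ℂ) {d : ℕ} (p : Fin (d + 1) → Polynomial ℂ) (z : ℂ) : ℂ :=
  ∑ j, (p j).eval z * f z ^ (j : ℕ)

/-- The index in `d + 1, …, d² + 2d` of a row of the Bautin matrix. -/
def rowIndex (r : Fin d × Fin (d + 1)) : ℕ := (d + 1) * ((r.1 : ℕ) + 1) + (r.2 : ℕ)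

theorem lt_rowIndex (r : Fin d × Fin (d + 1)) : d < rowIndex r := by
  have : (d + 1) * 1 ≤ (d + 1) * ((r.1 : ℕ) + 1) := Nat.mul_le_mul_left _ (by omega)
  unfold rowIndex
  omega

theorem rowIndex_le (r : Fin d × Fin (d + 1)) : rowIndex r ≤ d ^ 2 + 2 * d := by
  have h1 : (d + 1) * ((r.1 : ℕ) + 1) ≤ (d + 1) * d := Nat.mul_le_mul_left _ r.1.2
  have h2 := Nat.lt_succ_iff.1 r.2.2
  unfold rowIndex
  nlinarith

theorem analyticAt_polynomial (p : Polynomial ℂ) (z : ℂ) : AnalyticAt ℂ (fun w => p.eval w) z :=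
  p.differentiable.analyticAt z

theorem analyticAt_polyCombination (hf : AnalyticAt ℂ f z) (p : Fin (d + 1) → Polynomial ℂ) :
    AnalyticAt ℂ (polyCombination f p) z :=
  Finset.analyticAt_fun_sum _ fun j _ => (analyticAt_polynomial (p j) z).mul (hf.pow j)

/-- Vector of the Taylor coefficients at `z` of `p_1, …, p_d`. -/
def coeffVector (p : Fin (d + 1) → Polynomial ℂ) (z : ℂ) (c : Fin d × Fin (d + 1)) : ℂ :=
  taylorCoeff (fun w => (p c.1.succ).eval w) c.2 z

theorem coeffVector_zero (p : Fin (d + 1) → Polynomial ℂ) (c : Fin d × Fin (d + 1)) :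
    coeffVector p 0 c = (p c.1.succ).coeff c.2 :=
  taylorCoeff_polynomial_zero _ _

theorem analyticAt_coeffVector (p : Fin (d + 1) → Polynomial ℂ) (c : Fin d × Fin (d + 1)) :
    AnalyticAt ℂ (fun w => coeffVector p w c) z :=
  analyticAt_taylorCoeff (analyticAt_polynomial _ z) _

theorem bautinMatrix_mulVec (hf : AnalyticAt ℂ f z) {p : Fin (d + 1) → Polynomial ℂ}
    (hp : ∀ j, (p j).natDegree ≤ d) :
    (bautinMatrix f d z).mulVec (coeffVector p z) =
      fun r => taylorCoeff (polyCombination f p) (rowIndex r) z := by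
  funext r
  have hlt := lt_rowIndex r
  have hfj : ∀ j : ℕ, AnalyticAt ℂ (fun w => f w ^ j) z := fun j => hf.pow j
  have h1 : taylorCoeff (polyCombination f p) (rowIndex r) z =
      ∑ j : Fin (d + 1), ∑ k ∈ Finset.range (rowIndex r + 1),
        taylorCoeff (fun w => (p j).eval w) k z *
          taylorCoeff (fun w => f w ^ (j : ℕ)) (rowIndex r - k) z := by
    unfold polyCombination
    rw [taylorCoeff_sum _ (F := fun (j : Fin (d + 1)) w => (p j).eval w * f w ^ (j : ℕ))
      fun j _ => (analyticAt_polynomial (p j) z).mul (hfj j)]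
    exact Finset.sum_congr rfl fun j _ => taylorCoeff_mul (analyticAt_polynomial (p j) z) (hfj j) _
  have h2 : ∀ j : Fin (d + 1), ∑ k ∈ Finset.range (rowIndex r + 1),
        taylorCoeff (fun w => (p j).eval w) k z *
          taylorCoeff (fun w => f w ^ (j : ℕ)) (rowIndex r - k) z =
      ∑ k : Fin (d + 1), taylorCoeff (fun w => (p j).eval w) k z *
          taylorCoeff (fun w => f w ^ (j : ℕ)) (rowIndex r - k) z := by
    intro j
    rw [Fin.sum_univ_eq_sum_range (fun k => taylorCoeff (fun w => (p j).eval w) k z *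
          taylorCoeff (fun w => f w ^ (j : ℕ)) (rowIndex r - k) z) (d + 1)]
    symm
    refine Finset.sum_subset (Finset.range_subset_range.2 (by omega)) fun k _ hk => ?_
    rw [Finset.mem_range, not_lt] at hk
    rw [taylorCoeff_polynomial_eq_zero (lt_of_le_of_lt (hp j) (by omega)), zero_mul]
  -- The rows start at `d + 1`, so `rowIndex r - k ≥ 1` and the constant `f^0` contributes nothing:
  -- this is how `p_0` is eliminated.
  have h3 : ∀ k : Fin (d + 1), taylorCoeff (fun w => f w ^ ((0 : Fin (d + 1)) : ℕ))
      (rowIndex r - k) z = 0 := by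
    intro k
    have := taylorCoeff_polynomial_eq_zero (p := (1 : Polynomial ℂ)) (k := rowIndex r - k)
      (by have := k.2; simp; omega) z
    simpa using this
  rw [h1, Finset.sum_congr rfl fun j _ => h2 j, Fin.sum_univ_succ,
    Finset.sum_eq_zero fun k _ => by rw [h3, mul_zero], zero_add]
  simp only [Matrix.mulVec, dotProduct, Fintype.sum_prod_type]
  refine Finset.sum_congr rfl fun j _ => Finset.sum_congr rfl fun k _ => ?_
  simp [bautinMatrix, coeffVector, rowIndex, mul_comm]

/-- The adjugate form needs no invertibility, so it remains valid at `z = 0`, where `Δ_d` may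
vanish. -/
theorem bautinDet_mul_coeffVector (hf : AnalyticAt ℂ f z) {p : Fin (d + 1) → Polynomial ℂ}
    (hp : ∀ j, (p j).natDegree ≤ d) (c : Fin d × Fin (d + 1)) :
    bautinDet f d z * coeffVector p z c =
      ∑ r, (bautinMatrix f d z).adjugate c r *
        taylorCoeff (polyCombination f p) (rowIndex r) z := by
  have h := congrArg (fun v => (bautinMatrix f d z).adjugate.mulVec v c)
    (bautinMatrix_mulVec hf hp)
  simp only [Matrix.mulVec_mulVec, Matrix.adjugate_mul, Matrix.smul_mulVec, Matrix.one_mulVec]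
    at h
  exact h

theorem analyticAt_bautinMatrix (hf : AnalyticAt ℂ f z) (r c : Fin d × Fin (d + 1)) :
    AnalyticAt ℂ (fun w => bautinMatrix f d w r c) z :=
  analyticAt_taylorCoeff (hf.pow _) _

theorem analyticAt_bautinDet (hf : AnalyticAt ℂ f z) : AnalyticAt ℂ (bautinDet f d) z :=
  analyticAt_det (analyticAt_bautinMatrix hf)

theorem analyticAt_adjugate_bautinMatrix (hf : AnalyticAt ℂ f z) (c r : Fin d × Fin (d + 1)) :
    AnalyticAt ℂ (fun w => (bautinMatrix f d w).adjugate c r) z := by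
  simp only [Matrix.adjugate_apply]
  refine analyticAt_det fun i j => ?_
  simp only [Matrix.updateRow_apply]
  split_ifs
  · exact analyticAt_const
  · exact analyticAt_bautinMatrix hf _ _

theorem le_bautinMultiplicity (hf : AnalyticAt ℂ f 0) {p : Fin (d + 1) → Polynomial ℂ}
    (hp : ∀ j, (p j).natDegree ≤ d) {c : Fin d × Fin (d + 1)}
    (hc : (p c.1.succ).coeff c.2 ≠ 0) {n : ℕ}
    (hn : ((n + (d ^ 2 + 2 * d) : ℕ) : ℕ∞) ≤ analyticOrderAt (polyCombination f p) 0) :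
    (n : ℕ∞) ≤ bautinMultiplicity f d := by
  have hP := analyticAt_polyCombination hf p
  have hcv : analyticOrderAt (fun w => coeffVector p w c) 0 = 0 := by
    rw [(analyticAt_coeffVector p c).analyticOrderAt_eq_zero, coeffVector_zero]
    exact hc
  have h1 : (n : ℕ∞) ≤ analyticOrderAt (fun w => bautinDet f d w * coeffVector p w c) 0 := by
    have heq : (fun w => bautinDet f d w * coeffVector p w c) =ᶠ[nhds 0] fun w =>
        ∑ r, (bautinMatrix f d w).adjugate c r *
          taylorCoeff (polyCombination f p) (rowIndex r) w :=
      hf.eventually_analyticAt.mono fun w hw => bautinDet_mul_coeffVector hw hp c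
    rw [analyticOrderAt_congr heq]
    refine le_analyticOrderAt_sum _ (fun r _ => (analyticAt_adjugate_bautinMatrix hf c r).mul
      (analyticAt_taylorCoeff hP _)) fun r _ => ?_
    have := analyticOrderAt_mul (analyticAt_adjugate_bautinMatrix hf c r)
      (analyticAt_taylorCoeff hP (rowIndex r))
    refine le_trans ?_ this.ge
    exact (le_analyticOrderAt_taylorCoeff hP hn (rowIndex_le r)).trans le_add_self
  have h2 := analyticOrderAt_mul (analyticAt_bautinDet (d := d) hf) (analyticAt_coeffVector p c)
  rw [hcv, add_zero] at h2
  exact h1.trans h2.le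

theorem exists_coeff_ne_zero_or (p : Fin (d + 1) → Polynomial ℂ) (hp0 : p ≠ 0)
    (hp : ∀ j, (p j).natDegree ≤ d) :
    (∃ c : Fin d × Fin (d + 1), (p c.1.succ).coeff c.2 ≠ 0) ∨
      (∀ j : Fin d, p j.succ = 0) ∧ p 0 ≠ 0 := by
  by_cases h : ∀ j : Fin d, p j.succ = 0
  · refine Or.inr ⟨h, fun h0 => hp0 ?_⟩
    funext j
    exact Fin.cases h0 h j
  · push Not at h
    obtain ⟨j, hj⟩ := h
    exact Or.inl ⟨(j, ⟨(p j.succ).natDegree, Nat.lt_succ_iff.2 (hp _)⟩),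
      Polynomial.leadingCoeff_ne_zero.2 hj⟩

theorem analyticOrderAt_polyCombination_le (hf : AnalyticAt ℂ f 0)
    {p : Fin (d + 1) → Polynomial ℂ} (hp0 : p ≠ 0) (hp : ∀ j, (p j).natDegree ≤ d) :
    analyticOrderAt (polyCombination f p) 0 ≤
      bautinMultiplicity f d + ((d ^ 2 + 2 * d : ℕ) : ℕ∞) := by
  rcases exists_coeff_ne_zero_or p hp0 hp with ⟨c, hc⟩ | ⟨h1, h0⟩
  -- Testing against natural numbers also covers a combination that vanishes identically near `0`.
  · refine ENat.forall_natCast_le_iff_le.1 fun m hm => ?_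
    rcases le_total m (d ^ 2 + 2 * d) with h | h
    · exact le_add_left (by exact_mod_cast h)
    · obtain ⟨n, rfl⟩ := Nat.exists_eq_add_of_le' h
      have := le_bautinMultiplicity hf hp hc hm
      push_cast
      gcongr
  · have heq : polyCombination f p = fun w => (p 0).eval w := by
      funext w
      simp [polyCombination, Fin.sum_univ_succ, h1]
    rw [heq]
    have h2 : analyticOrderAt (fun w => (p 0).eval w) 0 ≤ (p 0).natDegree := by
      refine analyticOrderAt_le_of_taylorCoeff_ne_zero (analyticAt_polynomial _ _) ?_
      rw [taylorCoeff_polynomial_zero]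
      exact Polynomial.leadingCoeff_ne_zero.2 h0
    refine h2.trans (le_add_left ?_)
    have := hp 0
    exact_mod_cast this.trans (by nlinarith)

/-- Group the monomials of `P` by their power of the second variable. -/
theorem exists_polyCombination_eq_eval (f : ℂ → ℂ) {P : MvPolynomial (Fin 2) ℂ} (hP : P ≠ 0)
    (hd : P.totalDegree ≤ d) :
    ∃ p : Fin (d + 1) → Polynomial ℂ, p ≠ 0 ∧ (∀ j, (p j).natDegree ≤ d) ∧
      (fun z => MvPolynomial.eval ![z, f z] P) = polyCombination f p := by
  have hsupp : ∀ s ∈ P.support, s 0 + s 1 ≤ d := by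
    intro s hs
    have := (MvPolynomial.le_totalDegree hs).trans hd
    rwa [Finsupp.sum_fintype _ _ (by simp), Fin.sum_univ_two] at this
  let p : Fin (d + 1) → Polynomial ℂ := fun j =>
    ∑ s ∈ P.support with s 1 = (j : ℕ), Polynomial.monomial (s 0) (P.coeff s)
  refine ⟨p, ?_, fun j => ?_, ?_⟩
  · obtain ⟨s, hs⟩ := MvPolynomial.support_nonempty.2 hP
    intro h0
    have hsd := hsupp s hs
    have h1 := congrArg (fun q => Polynomial.coeff q (s 0))
      (congrFun h0 ⟨s 1, by omega⟩)
    simp only [p, Polynomial.finsetSum_coeff, Polynomial.coeff_monomial, Pi.zero_apply,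
      Polynomial.coeff_zero] at h1
    rw [Finset.sum_eq_single s] at h1
    · simp at h1
      exact (MvPolynomial.mem_support_iff.1 hs) h1
    · intro t ht hts
      rw [if_neg]
      intro h
      apply hts
      ext i
      fin_cases i
      · exact h
      · exact (Finset.mem_filter.1 ht).2
    · intro h
      exact (h (Finset.mem_filter.2 ⟨hs, rfl⟩)).elim
  · refine Polynomial.natDegree_sum_le_of_forall_le _ _ fun s hs => ?_
    have := hsupp s (Finset.mem_filter.1 hs).1
    exact (Polynomial.natDegree_monomial_le _).trans (by omega)
  · funext z
    simp only [polyCombination, p, Polynomial.eval_finsetSum, Polynomial.eval_monomial,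
      Finset.sum_mul]
    rw [MvPolynomial.eval_eq', ← Finset.sum_fiberwise_of_maps_to
      (s := P.support) (t := Finset.range (d + 1)) (g := fun s => s 1)
      (fun s hs => by have := hsupp s hs; simp; omega)]
    rw [← Fin.sum_univ_eq_sum_range (fun j => ∑ s ∈ P.support with s 1 = j,
      P.coeff s * ∏ i, ![z, f z] i ^ s i) (d + 1)]
    refine Finset.sum_congr rfl fun j _ => Finset.sum_congr rfl fun s hs => ?_
    rw [Fin.prod_univ_two, (Finset.mem_filter.1 hs).2]
    simp [mul_assoc]

theorem transcendenceIndex_le (hf : AnalyticAt ℂ f 0) (d : ℕ) :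
    transcendenceIndex f d ≤ bautinMultiplicity f d + ((d ^ 2 + 2 * d : ℕ) : ℕ∞) := by
  refine iSup_le fun P => iSup_le fun hP => iSup_le fun hd => ?_
  obtain ⟨p, hp0, hp, heq⟩ := exists_polyCombination_eq_eval f hP hd
  rw [heq]
  exact analyticOrderAt_polyCombination_le hf hp0 hp

end Cramer

/-! ### Zeros in a small disc force smallness -/

section Zeros

/-- The singularity of the quotient at `b` is removable. Orders at other points are kept so that
zeros can be divided out one after another. -/
theorem exists_eq_sub_pow_mul {g : ℂ → ℂ} {U : Set ℂ} (hg : AnalyticOnNhd ℂ g U) {b : ℂ}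
    (hb : b ∈ U) {n : ℕ} (hn : (n : ℕ∞) ≤ analyticOrderAt g b) :
    ∃ h : ℂ → ℂ, AnalyticOnNhd ℂ h U ∧ (∀ z, g z = (z - b) ^ n * h z) ∧
      ∀ z ∈ U, z ≠ b → analyticOrderAt h z = analyticOrderAt g z := by
  obtain ⟨g₀, hg₀, heq⟩ := (natCast_le_analyticOrderAt (hg b hb)).1 hn
  let h : ℂ → ℂ := Function.update (fun z => g z / (z - b) ^ n) b (g₀ b)
  have hmul : ∀ z, g z = (z - b) ^ n * h z := by
    intro z
    by_cases hz : z = b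
    · subst hz
      simpa [h] using heq.self_of_nhds
    · have : (z - b) ^ n ≠ 0 := pow_ne_zero _ (sub_ne_zero.2 hz)
      simp only [h, Function.update_of_ne hz]
      field_simp
  have han : AnalyticOnNhd ℂ h U := by
    intro z hz
    by_cases hzb : z = b
    · subst hzb
      refine hg₀.congr (heq.mono fun w hw => ?_)
      by_cases hwz : w = z
      · subst hwz; simp [h]
      · have h0 : (w - z) ^ n ≠ 0 := pow_ne_zero _ (sub_ne_zero.2 hwz)
        simp only [h, Function.update_of_ne hwz]
        rw [hw, smul_eq_mul]
        field_simp
    · have h0 : (z - b) ^ n ≠ 0 := pow_ne_zero _ (sub_ne_zero.2 hzb)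
      have h1 : AnalyticAt ℂ (fun w => g w / (w - b) ^ n) z :=
        (hg z hz).div ((analyticAt_id.sub analyticAt_const).pow n) h0
      refine h1.congr ?_
      filter_upwards [isOpen_ne.mem_nhds hzb] with w hw
      simp only [h, Function.update_of_ne hw]
  refine ⟨h, han, hmul, fun z hz hzb => ?_⟩
  have hpow : AnalyticAt ℂ (fun w : ℂ => (w - b) ^ n) z :=
    (analyticAt_id.sub analyticAt_const).pow n
  have h1 := analyticOrderAt_mul hpow (han z hz)
  rw [hpow.analyticOrderAt_eq_zero.2 (pow_ne_zero _ (sub_ne_zero.2 hzb)), zero_add] at h1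
  rw [← h1]
  congr 1
  funext w
  exact (hmul w).symm

theorem norm_le_of_le_norm_sphere {h : ℂ → ℂ}
    (hh : AnalyticOnNhd ℂ h (Metric.closedBall 0 1)) {C : ℝ}
    (hC : ∀ z ∈ Metric.sphere (0 : ℂ) 1, ‖h z‖ ≤ C) :
    ∀ z ∈ Metric.closedBall (0 : ℂ) 1, ‖h z‖ ≤ C := by
  intro z hz
  have hd : DiffContOnCl ℂ h (Metric.ball 0 1) := by
    apply DifferentiableOn.diffContOnCl
    rw [closure_ball _ one_ne_zero]
    exact hh.differentiableOn
  refine Complex.norm_le_of_forall_mem_frontier_norm_le Metric.isBounded_ball hd ?_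
    (by rwa [closure_ball _ one_ne_zero])
  rwa [frontier_ball _ one_ne_zero]

/-- Zeros in the disc of radius `1/4` make a function bounded on the unit disc small on the
disc of radius `1/4`. -/
theorem norm_le_of_zeros (s : Finset ℂ) (n : ℂ → ℕ) :
    ∀ (g : ℂ → ℂ) (C : ℝ), AnalyticOnNhd ℂ g (Metric.closedBall 0 1) →
      (∀ z ∈ Metric.closedBall (0 : ℂ) 1, ‖g z‖ ≤ C) →
      (∀ b ∈ s, b ∈ Metric.closedBall (0 : ℂ) (1 / 4)) →
      (∀ b ∈ s, (n b : ℕ∞) ≤ analyticOrderAt g b) →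
      ∀ z ∈ Metric.closedBall (0 : ℂ) (1 / 4), ‖g z‖ ≤ (2 / 3) ^ (∑ b ∈ s, n b) * C := by
  have hsub : Metric.closedBall (0 : ℂ) (1 / 4) ⊆ Metric.closedBall 0 1 :=
    Metric.closedBall_subset_closedBall (by norm_num)
  induction s using Finset.induction_on with
  | empty =>
    intro g C _ hC _ _ z hz
    simpa using hC z (hsub hz)
  | insert b s hbs ih =>
    intro g C hg hC hs hn z hz
    have hb := hs b (Finset.mem_insert_self b s)
    obtain ⟨h, hh, hmul, hord⟩ := exists_eq_sub_pow_mul hg (hsub hb)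
      (hn b (Finset.mem_insert_self b s))
    have hb' : ‖b‖ ≤ 1 / 4 := by simpa using hb
    have hz' : ‖z‖ ≤ 1 / 4 := by simpa using hz
    -- On the unit circle `‖w - b‖ ≥ 3/4`, while `‖z - b‖ ≤ 1/2` in the small disc: each zero gains
    -- `(1/2)(4/3) = 2/3`.
    have hsph : ∀ w ∈ Metric.sphere (0 : ℂ) 1, ‖h w‖ ≤ (4 / 3) ^ n b * C := by
      intro w hw
      have h1 : (3 / 4 : ℝ) ≤ ‖w - b‖ := by
        have := norm_sub_norm_le w b
        have hw1 : ‖w‖ = 1 := by simpa using hw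
        linarith
      have h2 : (3 / 4 : ℝ) ^ n b ≤ ‖w - b‖ ^ n b := by gcongr
      have h3 := hC w (Metric.sphere_subset_closedBall hw)
      rw [hmul w, norm_mul, norm_pow] at h3
      calc ‖h w‖ = (4 / 3) ^ n b * ((3 / 4) ^ n b * ‖h w‖) := by
            rw [← mul_assoc, ← mul_pow]; norm_num
        _ ≤ (4 / 3) ^ n b * (‖w - b‖ ^ n b * ‖h w‖) := by gcongr
        _ ≤ _ := by gcongr
    have h4 := ih h _ hh (norm_le_of_le_norm_sphere hh hsph)
      (fun c hc => hs c (Finset.mem_insert_of_mem hc))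
      (fun c hc => by
        have hcb : c ≠ b := fun h => hbs (h ▸ hc)
        rw [hord c (hsub (hs c (Finset.mem_insert_of_mem hc))) hcb]
        exact hn c (Finset.mem_insert_of_mem hc)) z hz
    have h5 : ‖z - b‖ ^ n b ≤ (1 / 2) ^ n b := by
      have := norm_sub_le z b
      gcongr
      linarith
    rw [hmul z, norm_mul, norm_pow, Finset.sum_insert hbs]
    calc ‖z - b‖ ^ n b * ‖h z‖
        ≤ (1 / 2) ^ n b * ((2 / 3) ^ (∑ b ∈ s, n b) * ((4 / 3) ^ n b * C)) := by gcongr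
      _ = ((1 / 2) * (4 / 3)) ^ n b * (2 / 3) ^ (∑ b ∈ s, n b) * C := by rw [mul_pow]; ring
      _ = _ := by rw [pow_add]; norm_num

theorem sum_enat_le_of_forall_le {ι : Type*} (s : Finset ι) (o : ι → ℕ∞) {B : ℕ}
    (h : ∀ n : ι → ℕ, (∀ b ∈ s, (n b : ℕ∞) ≤ o b) → ∑ b ∈ s, n b ≤ B) :
    ∑ b ∈ s, o b ≤ B := by
  classical
  have hfin : ∀ b ∈ s, o b ≠ ⊤ := by
    intro b hb htop
    -- A point of infinite order could carry the weight `B + 1` alone.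
    have := h (fun c => if c = b then B + 1 else 0) fun c _ => by
      by_cases hc : c = b
      · subst hc; simp [htop]
      · simp [hc]
    rw [Finset.sum_ite_eq' s b, if_pos hb] at this
    omega
  have h1 := h (fun b => (o b).toNat) fun b hb => (ENat.natCast_toNat (hfin b hb)).le
  calc ∑ b ∈ s, o b = ∑ b ∈ s, (((o b).toNat : ℕ) : ℕ∞) :=
        Finset.sum_congr rfl fun b hb => (ENat.natCast_toNat (hfin b hb)).symm
    _ = ((∑ b ∈ s, (o b).toNat : ℕ) : ℕ∞) := by push_cast; rfl
    _ ≤ B := by exact_mod_cast h1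

end Zeros

/-! ### Denominators and the lower bound for the leading coefficient -/

section Integrality

/-- The Taylor coefficients of `F` at `0` of index at most `L` become integers after multiplication
by `q`. -/
def IntegralTaylor (q : ℤ) (L : ℕ) (F : ℂ → ℂ) : Prop :=
  AnalyticAt ℂ F 0 ∧
    ∀ m ≤ L, (q : ℂ) * taylorCoeff F m 0 ∈ (Int.castRingHom ℂ).range

variable {F G : ℂ → ℂ} {q q' : ℤ} {L : ℕ}

theorem intCast_mem_range (n : ℤ) : (n : ℂ) ∈ (Int.castRingHom ℂ).range := ⟨n, rfl⟩

theorem IntegralTaylor.mul (hF : IntegralTaylor q L F) (hG : IntegralTaylor q' L G) :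
    IntegralTaylor (q * q') L (fun w => F w * G w) := by
  refine ⟨hF.1.mul hG.1, fun m hm => ?_⟩
  rw [taylorCoeff_mul hF.1 hG.1, Finset.mul_sum]
  refine Subring.sum_mem _ fun i hi => ?_
  have hi' := Finset.mem_range.1 hi
  have := Subring.mul_mem _ (hF.2 i (by omega)) (hG.2 (m - i) (by omega))
  convert this using 1
  push_cast
  ring

theorem IntegralTaylor.const_mul (hF : IntegralTaylor q L F) (c : ℤ) :
    IntegralTaylor q L (fun w => (c : ℂ) * F w) := by
  refine ⟨analyticAt_const.mul hF.1, fun m hm => ?_⟩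
  rw [taylorCoeff_const_mul, mul_left_comm]
  exact Subring.mul_mem _ (intCast_mem_range c) (hF.2 m hm)

theorem IntegralTaylor.of_dvd (hF : IntegralTaylor q L F) (h : q ∣ q') :
    IntegralTaylor q' L F := by
  obtain ⟨c, rfl⟩ := h
  refine ⟨hF.1, fun m hm => ?_⟩
  have := Subring.mul_mem _ (intCast_mem_range c) (hF.2 m hm)
  convert this using 1
  push_cast
  ring

theorem IntegralTaylor.one : IntegralTaylor 1 L (fun _ => 1) := by
  refine ⟨analyticAt_const, fun m _ => ?_⟩
  have := taylorCoeff_polynomial_zero (1 : Polynomial ℂ) m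
  simp only [Polynomial.eval_one] at this
  rw [this, Polynomial.coeff_one]
  split_ifs
  · simp
  · simp

theorem IntegralTaylor.prod {ι : Type*} (s : Finset ι) {F : ι → ℂ → ℂ}
    (h : ∀ i ∈ s, IntegralTaylor q L (F i)) :
    IntegralTaylor (q ^ s.card) L (fun w => ∏ i ∈ s, F i w) := by
  classical
  induction s using Finset.induction_on with
  | empty => simpa using IntegralTaylor.one
  | insert i s hi ih =>
    have := (h i (Finset.mem_insert_self i s)).mul
      (ih fun j hj => h j (Finset.mem_insert_of_mem hj))
    simp only [Finset.prod_insert hi, Finset.card_insert_of_notMem hi, pow_succ']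
    exact this

theorem IntegralTaylor.sum {ι : Type*} (s : Finset ι) {F : ι → ℂ → ℂ}
    (h : ∀ i ∈ s, IntegralTaylor q L (F i)) :
    IntegralTaylor q L (fun w => ∑ i ∈ s, F i w) := by
  refine ⟨Finset.analyticAt_fun_sum s fun i hi => (h i hi).1, fun m hm => ?_⟩
  rw [taylorCoeff_sum s fun i hi => (h i hi).1, Finset.mul_sum]
  exact Subring.sum_mem _ fun i hi => (h i hi).2 m hm

theorem IntegralTaylor.pow (hF : IntegralTaylor q L F) (n : ℕ) :
    IntegralTaylor (q ^ n) L (fun w => F w ^ n) := by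
  simpa using IntegralTaylor.prod (Finset.range n) (F := fun _ => F) fun _ _ => hF

theorem IntegralTaylor.taylorCoeff {l m : ℕ} (hF : IntegralTaylor q L F) (hl : m + l ≤ L) :
    IntegralTaylor q l (fun w => taylorCoeff F m w) := by
  refine ⟨analyticAt_taylorCoeff hF.1 m, fun k hk => ?_⟩
  rw [taylorCoeff_taylorCoeff, mul_left_comm]
  exact Subring.mul_mem _ (by simp)
    (hF.2 _ (by omega))

theorem IntegralTaylor.det {ι : Type*} [Fintype ι] [DecidableEq ι] {A : ℂ → Matrix ι ι ℂ}
    (hA : ∀ i j, IntegralTaylor q L (fun w => A w i j)) :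
    IntegralTaylor (q ^ Fintype.card ι) L (fun w => (A w).det) := by
  simp only [Matrix.det_apply']
  refine IntegralTaylor.sum _ fun σ _ => ?_
  exact (IntegralTaylor.prod Finset.univ fun i _ => hA (σ i) i).const_mul _

/-- A nonzero integer has absolute value at least `1`. -/
theorem IntegralTaylor.one_le_norm (hF : IntegralTaylor q L F) {m : ℕ} (hm : m ≤ L) (hq : q ≠ 0)
    (h0 : BautinBezout.taylorCoeff F m 0 ≠ 0) :
    1 ≤ ‖(q : ℂ)‖ * ‖BautinBezout.taylorCoeff F m 0‖ := by
  obtain ⟨n, hn⟩ := hF.2 m hm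
  rw [← norm_mul, ← hn]
  have hn0 : n ≠ 0 := by
    rintro rfl
    rw [map_zero] at hn
    exact mul_ne_zero (by exact_mod_cast hq) h0 hn.symm
  rw [eq_intCast, Complex.norm_intCast]
  exact_mod_cast Int.one_le_abs hn0

theorem integralTaylor_of_rat {f : ℂ → ℂ} (hf : AnalyticAt ℂ f 0) {a : ℕ → ℚ}
    (ha : ∀ k, BautinBezout.taylorCoeff f k 0 = (a k : ℂ)) (N : ℕ) :
    IntegralTaylor ((∏ k ∈ Finset.range (N + 1), (a k).den : ℕ) : ℤ) N f := by
  refine ⟨hf, fun m hm => ?_⟩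
  obtain ⟨c, hc⟩ : (a m).den ∣ ∏ k ∈ Finset.range (N + 1), (a k).den :=
    Finset.dvd_prod_of_mem _ (Finset.mem_range.2 (by omega))
  rw [ha, hc]
  have h1 : ((a m).den : ℂ) * (a m : ℂ) = ((a m).num : ℂ) := by
    exact_mod_cast Rat.den_mul_eq_num (a m)
  convert intCast_mem_range ((c : ℤ) * (a m).num) using 1
  push_cast
  rw [← h1]
  ring

/-- Lower bound for the leading Taylor coefficient of the Bautin determinant. -/
theorem one_le_norm_taylorCoeff_bautinDet {f : ℂ → ℂ} (hf : AnalyticAt ℂ f 0) {a : ℕ → ℚ}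
    (ha : ∀ k, BautinBezout.taylorCoeff f k 0 = (a k : ℂ)) {d η : ℕ}
    (hη : bautinMultiplicity f d = η) :
    1 ≤ ((∏ k ∈ Finset.range (d ^ 2 + 2 * d + η + 1), (a k).den : ℕ) : ℝ) ^ (d * (d * (d + 1))) *
      ‖BautinBezout.taylorCoeff (bautinDet f d) η 0‖ := by
  set D := ∏ k ∈ Finset.range (d ^ 2 + 2 * d + η + 1), (a k).den with hD
  have hD0 : D ≠ 0 := Finset.prod_ne_zero_iff.2 fun k _ => (a k).den_ne_zero
  -- Entries are coefficients of `f^j`, `j ≤ d`, of index at most `d² + 2d`, expanded up to order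
  -- `η`; thus only coefficients of `f` up to `d² + 2d + η` enter, each entry costing `D ^ d`.
  have h1 : ∀ r c : Fin d × Fin (d + 1),
      IntegralTaylor ((D : ℤ) ^ d) η (fun w => bautinMatrix f d w r c) := by
    intro r c
    have h2 := (integralTaylor_of_rat hf ha (d ^ 2 + 2 * d + η)).pow ((c.1 : ℕ) + 1)
    have hr := rowIndex_le r
    refine (IntegralTaylor.taylorCoeff h2 ?_).of_dvd (pow_dvd_pow _ c.1.2)
    unfold rowIndex at hr
    omega
  have h3 := (IntegralTaylor.det h1).one_le_norm le_rfl
    (pow_ne_zero _ (pow_ne_zero _ (by exact_mod_cast hD0)))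
    (taylorCoeff_ne_zero_of_analyticOrderAt_eq (analyticAt_bautinDet hf) hη)
  simp only [Fintype.card_prod, Fintype.card_fin, ← pow_mul] at h3
  push_cast at h3
  rw [norm_pow, Complex.norm_natCast] at h3
  exact h3

end Integrality

/-! ### Coefficients dominated by the size near the origin, and the zero bound -/

section Domination

variable {f : ℂ → ℂ} {d : ℕ} {M : ℝ}

theorem norm_eval_le {p : Polynomial ℂ} {μ : ℝ} (hp : p.natDegree ≤ d)
    (hμ : ∀ k, ‖p.coeff k‖ ≤ μ) {z : ℂ} (hz : z ∈ Metric.closedBall (0 : ℂ) 1) :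
    ‖p.eval z‖ ≤ (d + 1) * μ := by
  have hz' : ‖z‖ ≤ 1 := by simpa using hz
  have hμ0 : 0 ≤ μ := (norm_nonneg _).trans (hμ 0)
  rw [Polynomial.eval_eq_sum_range' (Nat.lt_succ_of_le hp)]
  calc _ ≤ ∑ i ∈ Finset.range (d + 1), ‖p.coeff i * z ^ i‖ := norm_sum_le _ _
    _ ≤ ∑ i ∈ Finset.range (d + 1), μ := by
      refine Finset.sum_le_sum fun i _ => ?_
      rw [norm_mul, norm_pow]
      calc _ ≤ μ * 1 := by
            gcongr
            · exact hμ i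
            · exact pow_le_one₀ (norm_nonneg _) hz'
        _ = μ := mul_one μ
    _ = _ := by simp

theorem norm_polyCombination_le (hM : 1 ≤ M) {p : Fin (d + 1) → Polynomial ℂ} {μ : ℝ}
    (hp : ∀ j, (p j).natDegree ≤ d) (hμ : ∀ j k, ‖(p j).coeff k‖ ≤ μ) {z : ℂ}
    (hz : z ∈ Metric.closedBall (0 : ℂ) 1) (hfM : ‖f z‖ ≤ M) :
    ‖polyCombination f p z‖ ≤ (d + 1) ^ 2 * M ^ d * μ := by
  have hμ0 : 0 ≤ μ := (norm_nonneg _).trans (hμ 0 0)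
  calc _ ≤ ∑ j : Fin (d + 1), ‖(p j).eval z * f z ^ (j : ℕ)‖ := norm_sum_le _ _
    _ ≤ ∑ j : Fin (d + 1), ((d + 1) * μ) * M ^ d := by
      refine Finset.sum_le_sum fun j _ => ?_
      rw [norm_mul, norm_pow]
      gcongr
      · exact norm_eval_le (hp j) (hμ j) hz
      · exact (pow_le_pow_left₀ (norm_nonneg _) hfM _).trans
          (pow_le_pow_right₀ hM (Nat.lt_succ_iff.1 j.2))
    _ = _ := by
      simp
      ring

theorem norm_bautinMatrix_le (hf : AnalyticOnNhd ℂ f (Metric.closedBall 0 1)) (hM : 1 ≤ M)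
    (hfM : ∀ z ∈ Metric.closedBall (0 : ℂ) 1, ‖f z‖ ≤ M) {w : ℂ}
    (hw : w ∈ Metric.closedBall (0 : ℂ) (1 / 8)) (r c : Fin d × Fin (d + 1)) :
    ‖bautinMatrix f d w r c‖ ≤ M ^ d * 8 ^ (d ^ 2 + 2 * d) := by
  have hsub : Metric.closedBall w (1 / 8) ⊆ Metric.closedBall (0 : ℂ) 1 := by
    refine Metric.closedBall_subset_closedBall' ?_
    have := Metric.mem_closedBall.1 hw
    linarith
  have hr := rowIndex_le r
  calc _ ≤ M ^ ((c.1 : ℕ) + 1) / (1 / 8) ^ (rowIndex r - (c.2 : ℕ)) :=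
        norm_taylorCoeff_le (by norm_num) (fun z hz => (hf z (hsub hz)).pow _)
          (fun z hz => by
            rw [Pi.pow_apply, norm_pow]
            exact pow_le_pow_left₀ (norm_nonneg _) (hfM z (hsub hz)) _) _
    _ = M ^ ((c.1 : ℕ) + 1) * 8 ^ (rowIndex r - (c.2 : ℕ)) := by
      rw [one_div, inv_pow, div_inv_eq_mul]
    _ ≤ _ := by
      gcongr
      · exact c.1.2
      · norm_num
      · exact (Nat.sub_le _ _).trans hr

theorem norm_det_le {ι : Type*} [Fintype ι] [DecidableEq ι] {A : Matrix ι ι ℂ} {B : ℝ}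
    (hA : ∀ i j, ‖A i j‖ ≤ B) : ‖A.det‖ ≤ (Fintype.card ι).factorial * B ^ Fintype.card ι := by
  have := Matrix.det_le (abv := IsAbsoluteValue.toAbsoluteValue (norm : ℂ → ℝ)) hA
  rwa [nsmul_eq_mul] at this

/-- A cofactor is the determinant with one row replaced by a unit vector; `1 ≤ B` lets the same
entry bound cover that row. -/
theorem norm_adjugate_le {ι : Type*} [Fintype ι] [DecidableEq ι] {A : Matrix ι ι ℂ} {B : ℝ}
    (hB : 1 ≤ B) (hA : ∀ i j, ‖A i j‖ ≤ B) (i j : ι) :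
    ‖A.adjugate i j‖ ≤ (Fintype.card ι).factorial * B ^ Fintype.card ι := by
  rw [Matrix.adjugate_apply]
  refine norm_det_le fun k l => ?_
  rw [Matrix.updateRow_apply]
  split_ifs
  · rw [Pi.single_apply]
    split_ifs
    · simpa using hB
    · simpa using zero_le_one.trans hB
  · exact hA k l

/-- The leading Taylor coefficient of the Bautin determinant controls the coefficients of
`p_1, …, p_d` by the size of `∑ j, p_j f ^ j` near `0`. -/
theorem norm_taylorCoeff_bautinDet_mul_coeff_le
    (hf : AnalyticOnNhd ℂ f (Metric.closedBall 0 1)) (hM : 1 ≤ M)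
    (hfM : ∀ z ∈ Metric.closedBall (0 : ℂ) 1, ‖f z‖ ≤ M)
    {p : Fin (d + 1) → Polynomial ℂ} (hp : ∀ j, (p j).natDegree ≤ d) {ε : ℝ}
    (hε : ∀ z ∈ Metric.closedBall (0 : ℂ) (1 / 4), ‖polyCombination f p z‖ ≤ ε)
    {η : ℕ} (hη : bautinMultiplicity f d = η) (c : Fin d × Fin (d + 1)) :
    ‖taylorCoeff (bautinDet f d) η 0‖ * ‖(p c.1.succ).coeff c.2‖ ≤
      8 ^ η * ((d * (d + 1) : ℕ) * (((d * (d + 1)).factorial *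
        (M ^ d * 8 ^ (d ^ 2 + 2 * d)) ^ (d * (d + 1))) * (8 ^ (d ^ 2 + 2 * d) * ε))) := by
  have h18 : Metric.closedBall (0 : ℂ) (1 / 8) ⊆ Metric.closedBall 0 1 :=
    Metric.closedBall_subset_closedBall (by norm_num)
  have h14 : Metric.closedBall (0 : ℂ) (1 / 4) ⊆ Metric.closedBall 0 1 :=
    Metric.closedBall_subset_closedBall (by norm_num)
  have hf0 : AnalyticAt ℂ f 0 := hf 0 (by simp)
  have hε0 : 0 ≤ ε := (norm_nonneg _).trans (hε 0 (by simp))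
  have hB : 1 ≤ M ^ d * 8 ^ (d ^ 2 + 2 * d) :=
    one_le_mul_of_one_le_of_one_le (one_le_pow₀ hM) (one_le_pow₀ (by norm_num))
  have hbound : ∀ w ∈ Metric.closedBall (0 : ℂ) (1 / 8),
      ‖bautinDet f d w * coeffVector p w c‖ ≤ (d * (d + 1) : ℕ) * (((d * (d + 1)).factorial *
        (M ^ d * 8 ^ (d ^ 2 + 2 * d)) ^ (d * (d + 1))) * (8 ^ (d ^ 2 + 2 * d) * ε)) := by
    intro w hw
    -- The radius `1/4` is split in two: base points range over radius `1/8`, leaving discs of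
    -- radius `1/8` for Cauchy's estimate.
    have hsub : Metric.closedBall w (1 / 8) ⊆ Metric.closedBall (0 : ℂ) (1 / 4) := by
      refine Metric.closedBall_subset_closedBall' ?_
      have := Metric.mem_closedBall.1 hw
      linarith
    rw [bautinDet_mul_coeffVector (hf w (h18 hw)) hp c]
    refine (norm_sum_le_of_le _ fun r _ => ?_).trans (b := ∑ _r : Fin d × Fin (d + 1),
      (((d * (d + 1)).factorial * (M ^ d * 8 ^ (d ^ 2 + 2 * d)) ^ (d * (d + 1))) *
        (8 ^ (d ^ 2 + 2 * d) * ε))) ?_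
    · rw [norm_mul]
      gcongr
      · simpa using norm_adjugate_le hB (norm_bautinMatrix_le hf hM hfM hw) c r
      · calc _ ≤ ε / (1 / 8) ^ rowIndex r :=
              norm_taylorCoeff_le (by norm_num)
                (fun z hz => analyticAt_polyCombination (hf z (h14 (hsub hz))) p)
                (fun z hz => hε z (hsub hz)) _
          _ = 8 ^ rowIndex r * ε := by
              rw [one_div, inv_pow, div_inv_eq_mul, mul_comm]
          _ ≤ _ := by
              gcongr
              · norm_num
              · exact rowIndex_le r
    · simp
  have h1 := taylorCoeff_mul_of_order (analyticAt_bautinDet hf0) (analyticAt_coeffVector p c)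
    (show (η : ℕ∞) ≤ analyticOrderAt (bautinDet f d) 0 from hη.ge)
  rw [coeffVector_zero] at h1
  rw [← norm_mul, ← h1]
  calc _ ≤ _ := norm_taylorCoeff_le (by norm_num)
        (fun w hw => (analyticAt_bautinDet (hf w (h18 hw))).mul (analyticAt_coeffVector p c))
        hbound η
    _ = _ := by rw [one_div, inv_pow, div_inv_eq_mul, mul_comm]

/-- The Bautin matrix does not see `p_0`, so it is recovered by subtracting the other terms from the
whole combination. -/
theorem norm_coeff_zero_le (hM : 1 ≤ M)
    (hfM : ∀ z ∈ Metric.closedBall (0 : ℂ) 1, ‖f z‖ ≤ M)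
    {p : Fin (d + 1) → Polynomial ℂ} (hp : ∀ j, (p j).natDegree ≤ d) {ε X : ℝ} (hX : 0 ≤ X)
    (hε : ∀ z ∈ Metric.closedBall (0 : ℂ) (1 / 4), ‖polyCombination f p z‖ ≤ ε)
    (hpX : ∀ (j : Fin d) k, ‖(p j.succ).coeff k‖ ≤ X) {k : ℕ} (hk : k ≤ d) :
    ‖(p 0).coeff k‖ ≤ 8 ^ d * (ε + (d + 1) ^ 2 * M ^ d * X) := by
  have h18 : Metric.closedBall (0 : ℂ) (1 / 8) ⊆ Metric.closedBall 0 (1 / 4) :=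
    Metric.closedBall_subset_closedBall (by norm_num)
  have h14 : Metric.closedBall (0 : ℂ) (1 / 4) ⊆ Metric.closedBall 0 1 :=
    Metric.closedBall_subset_closedBall (by norm_num)
  have hε0 : 0 ≤ ε := (norm_nonneg _).trans (hε 0 (by simp))
  let q : Fin (d + 1) → Polynomial ℂ := Fin.cons 0 fun j => p j.succ
  have hq : ∀ j, (q j).natDegree ≤ d := fun j => Fin.cases (by simp [q]) (fun j => hp j.succ) j
  have hqX : ∀ j k, ‖(q j).coeff k‖ ≤ X :=
    fun j k => Fin.cases (by simpa [q] using hX) (fun j => hpX j k) j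
  have hpq : ∀ z, (p 0).eval z = polyCombination f p z - polyCombination f q z := by
    intro z
    simp [polyCombination, Fin.sum_univ_succ, q]
  have h1 : ∀ z ∈ Metric.closedBall (0 : ℂ) (1 / 8),
      ‖(p 0).eval z‖ ≤ ε + (d + 1) ^ 2 * M ^ d * X := by
    intro z hz
    rw [hpq]
    exact (norm_sub_le _ _).trans (add_le_add (hε z (h18 hz))
      (norm_polyCombination_le hM hq hqX (h14 (h18 hz)) (hfM z (h14 (h18 hz)))))
  rw [← taylorCoeff_polynomial_zero]
  calc _ ≤ (ε + (d + 1) ^ 2 * M ^ d * X) / (1 / 8) ^ k :=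
        norm_taylorCoeff_le (by norm_num) (fun w _ => analyticAt_polynomial _ w) h1 k
    _ = 8 ^ k * (ε + (d + 1) ^ 2 * M ^ d * X) := by
      rw [one_div, inv_pow, div_inv_eq_mul, mul_comm]
    _ ≤ _ := by
      gcongr
      norm_num

theorem exists_forall_norm_coeff_le {p : Fin (d + 1) → Polynomial ℂ} (hp0 : p ≠ 0)
    (hp : ∀ j, (p j).natDegree ≤ d) :
    ∃ (j : Fin (d + 1)) (k : Fin (d + 1)), 0 < ‖(p j).coeff k‖ ∧
      ∀ j' k', ‖(p j').coeff k'‖ ≤ ‖(p j).coeff k‖ := by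
  obtain ⟨⟨j, k⟩, hjk⟩ := Finite.exists_max
    fun c : Fin (d + 1) × Fin (d + 1) => ‖(p c.1).coeff c.2‖
  have hall : ∀ j' k', ‖(p j').coeff k'‖ ≤ ‖(p j).coeff k‖ := by
    intro j' k'
    by_cases h : k' < d + 1
    · exact hjk (j', ⟨k', h⟩)
    · rw [Polynomial.coeff_eq_zero_of_natDegree_lt (lt_of_le_of_lt (hp j') (by omega)), norm_zero]
      exact norm_nonneg _
  refine ⟨j, k, ?_, hall⟩
  by_contra! h
  apply hp0
  funext j'
  ext k'
  simpa using (hall j' k').trans h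

/-- The bound for the coefficients of `p_1, …, p_d` relative to the size of `∑ j, p_j f ^ j`. -/
def dominationConst (M D : ℝ) (d η : ℕ) : ℝ :=
  D ^ (d * (d * (d + 1))) * (8 ^ η * ((d * (d + 1) : ℕ) * (((d * (d + 1)).factorial *
    (M ^ d * 8 ^ (d ^ 2 + 2 * d)) ^ (d * (d + 1))) * 8 ^ (d ^ 2 + 2 * d))))

theorem dominationConst_nonneg {D : ℝ} (hM : 1 ≤ M) (hD : 0 ≤ D) (d η : ℕ) :
    0 ≤ dominationConst M D d η := by
  unfold dominationConst
  positivity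

theorem pow_sum_le (hf : AnalyticOnNhd ℂ f (Metric.closedBall 0 1)) (hM : 1 ≤ M)
    (hfM : ∀ z ∈ Metric.closedBall (0 : ℂ) 1, ‖f z‖ ≤ M)
    {p : Fin (d + 1) → Polynomial ℂ} (hp0 : p ≠ 0) (hp : ∀ j, (p j).natDegree ≤ d)
    {η : ℕ} (hη : bautinMultiplicity f d = η) {D : ℝ} (hD0 : 0 ≤ D)
    (hD : 1 ≤ D ^ (d * (d * (d + 1))) * ‖taylorCoeff (bautinDet f d) η 0‖)
    {s : Finset ℂ} (hs : (s : Set ℂ) ⊆ Metric.closedBall 0 (1 / 4)) {n : ℂ → ℕ}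
    (hn : ∀ b ∈ s, (n b : ℕ∞) ≤ analyticOrderAt (polyCombination f p) b) :
    (3 / 2 : ℝ) ^ (∑ b ∈ s, n b) ≤
      8 ^ d * (d + 1) ^ 4 * M ^ (2 * d) * (1 + dominationConst M D d η) := by
  obtain ⟨j, k, hpos, hmax⟩ := exists_forall_norm_coeff_le hp0 hp
  set μ := ‖(p j).coeff k‖ with hμ
  set ν := ∑ b ∈ s, n b with hν
  set W := dominationConst M D d η with hW
  have hW0 : 0 ≤ W := dominationConst_nonneg hM hD0 d η
  set ε := (2 / 3 : ℝ) ^ ν * ((d + 1) ^ 2 * M ^ d * μ) with hεdef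
  have hε0 : 0 ≤ ε := by positivity
  have hε : ∀ z ∈ Metric.closedBall (0 : ℂ) (1 / 4), ‖polyCombination f p z‖ ≤ ε :=
    norm_le_of_zeros s n (polyCombination f p) _
      (fun z hz => analyticAt_polyCombination (hf z hz) p)
      (fun z hz => norm_polyCombination_le hM hp hmax hz (hfM z hz)) (fun b hb => hs hb) hn
  have hX : ∀ (j : Fin d) k, ‖(p j.succ).coeff k‖ ≤ W * ε := by
    intro j k
    by_cases hk : k < d + 1
    · have h1 := norm_taylorCoeff_bautinDet_mul_coeff_le hf hM hfM hp hε hη (j, ⟨k, hk⟩)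
      calc ‖(p j.succ).coeff k‖ = 1 * ‖(p j.succ).coeff k‖ := (one_mul _).symm
        _ ≤ (D ^ (d * (d * (d + 1))) * ‖taylorCoeff (bautinDet f d) η 0‖) *
            ‖(p j.succ).coeff k‖ := by gcongr
        _ = D ^ (d * (d * (d + 1))) * (‖taylorCoeff (bautinDet f d) η 0‖ *
            ‖(p j.succ).coeff k‖) := by ring
        _ ≤ _ := mul_le_mul_of_nonneg_left h1 (by positivity)
        _ = W * ε := by rw [hW, dominationConst]; ring
    · rw [Polynomial.coeff_eq_zero_of_natDegree_lt (lt_of_le_of_lt (hp _) (by omega)), norm_zero]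
      positivity
  have h8 : (1 : ℝ) ≤ 8 ^ d := one_le_pow₀ (by norm_num)
  have hA : (1 : ℝ) ≤ (d + 1) ^ 2 * M ^ d :=
    one_le_mul_of_one_le_of_one_le (one_le_pow₀ (by linarith [(Nat.cast_nonneg d : (0 : ℝ) ≤ d)]))
      (one_le_pow₀ hM)
  -- The largest coefficient may belong to `p_0` or to a later `p_j`; one bound serves both cases.
  -- Since `ε` is itself a multiple of `μ`, this closes the loop and `μ` cancels.
  have hμε : μ ≤ 8 ^ d * ((d + 1) ^ 2 * M ^ d) * (1 + W) * ε := by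
    have h2 : ε + (d + 1) ^ 2 * M ^ d * (W * ε) ≤ ((d + 1) ^ 2 * M ^ d) * (1 + W) * ε := by
      nlinarith [mul_le_mul_of_nonneg_right hA hε0]
    rcases Fin.eq_zero_or_eq_succ j with hj | ⟨i, hj⟩
    · have h1 := norm_coeff_zero_le hM hfM hp (mul_nonneg hW0 hε0) hε hX
        (Nat.lt_succ_iff.1 k.2)
      rw [hμ, hj]
      calc _ ≤ _ := h1
        _ ≤ 8 ^ d * (((d + 1) ^ 2 * M ^ d) * (1 + W) * ε) := by gcongr
        _ = _ := by ring
    · rw [hμ, hj]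
      calc _ ≤ W * ε := hX i k
        _ ≤ 1 * 1 * (1 + W) * ε := by
          gcongr
          linarith
        _ ≤ _ := by gcongr
  have h3 : (3 / 2 : ℝ) ^ ν * (2 / 3) ^ ν = 1 := by
    rw [← mul_pow]
    norm_num
  have h4 : (3 / 2 : ℝ) ^ ν * μ ≤
      (8 ^ d * (d + 1) ^ 4 * M ^ (2 * d) * (1 + W)) * μ := by
    calc (3 / 2 : ℝ) ^ ν * μ ≤ (3 / 2 : ℝ) ^ ν * (8 ^ d * ((d + 1) ^ 2 * M ^ d) * (1 + W) * ε) := by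
          gcongr
      _ = ((3 / 2 : ℝ) ^ ν * (2 / 3) ^ ν) *
          ((8 ^ d * (d + 1) ^ 4 * M ^ (2 * d) * (1 + W)) * μ) := by
          rw [hεdef]
          ring
      _ = _ := by rw [h3, one_mul]
  exact le_of_mul_le_mul_right h4 hpos

theorem natCast_le_exp (n : ℕ) : (n : ℝ) ≤ Real.exp n := by
  linarith [Real.add_one_le_exp (n : ℝ)]

/-- The exponent of an explicit bound for `dominationConst`. -/
def zeroExponent (m Λ : ℝ) (d η : ℕ) : ℝ :=
  7 * d + 2 * d * m + 1 + (d * (d * (d + 1)) * Λ + 3 * η + d * (d + 1) + (d * (d + 1)) ^ 2 +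
    d * (d + 1) * (d * m + 3 * (d ^ 2 + 2 * d)) + 3 * (d ^ 2 + 2 * d))

theorem le_exp_zeroExponent {m Λ D : ℝ} (hm : 0 ≤ m) (hΛ : 0 ≤ Λ) (hD0 : 0 ≤ D)
    (hD : D ≤ Real.exp Λ) (d η : ℕ) :
    8 ^ d * (d + 1) ^ 4 * Real.exp m ^ (2 * d) * (1 + dominationConst (Real.exp m) D d η) ≤
      Real.exp (zeroExponent m Λ d η) := by
  have h8 : (8 : ℝ) ≤ Real.exp 3 := by
    have h1 : (2 : ℝ) ≤ Real.exp 1 := by linarith [Real.add_one_le_exp (1 : ℝ)]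
    calc (8 : ℝ) = 2 ^ 3 := by norm_num
      _ ≤ Real.exp 1 ^ 3 := by gcongr
      _ = Real.exp 3 := by rw [← Real.exp_nat_mul]; norm_num
  have h8n : ∀ n : ℕ, (8 : ℝ) ^ n ≤ Real.exp (3 * n) := by
    intro n
    rw [mul_comm, Real.exp_nat_mul]
    gcongr
  set Y := (d * (d * (d + 1)) * Λ + 3 * η + d * (d + 1) + (d * (d + 1)) ^ 2 +
    d * (d + 1) * (d * m + 3 * (d ^ 2 + 2 * d)) + 3 * (d ^ 2 + 2 * d) : ℝ) with hY
  have hY0 : 0 ≤ Y := by positivity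
  have hW : dominationConst (Real.exp m) D d η ≤ Real.exp Y := by
    have hf1 : ((d * (d + 1)).factorial : ℝ) ≤ Real.exp ((d * (d + 1) : ℕ) * (d * (d + 1) : ℕ)) := by
      calc ((d * (d + 1)).factorial : ℝ) ≤ ((d * (d + 1) : ℕ) : ℝ) ^ (d * (d + 1)) := by
            exact_mod_cast Nat.factorial_le_pow _
        _ ≤ Real.exp ((d * (d + 1) : ℕ)) ^ (d * (d + 1)) := by
            gcongr
            exact natCast_le_exp _
        _ = _ := by rw [← Real.exp_nat_mul]
    have hB : Real.exp m ^ d * 8 ^ (d ^ 2 + 2 * d) ≤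
        Real.exp (d * m + 3 * ((d ^ 2 + 2 * d : ℕ) : ℝ)) := by
      rw [Real.exp_add, Real.exp_nat_mul]
      gcongr
      exact h8n _
    unfold dominationConst
    calc _ ≤ Real.exp Λ ^ (d * (d * (d + 1))) * (Real.exp (3 * η) *
          (Real.exp (d * (d + 1) : ℕ) * ((Real.exp ((d * (d + 1) : ℕ) * (d * (d + 1) : ℕ)) *
          Real.exp (d * m + 3 * ((d ^ 2 + 2 * d : ℕ) : ℝ)) ^ (d * (d + 1))) *
          Real.exp (3 * ((d ^ 2 + 2 * d : ℕ) : ℝ))))) := by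
          gcongr
          · exact h8n _
          · exact natCast_le_exp _
          · exact h8n _
      _ = Real.exp Y := by
          simp only [← Real.exp_nat_mul, ← Real.exp_add]
          congr 1
          rw [hY]
          push_cast
          ring
  -- Since `Y ≥ 0`, `1 + exp Y ≤ 2 exp Y ≤ exp (1 + Y)`.
  have h1W : 1 + dominationConst (Real.exp m) D d η ≤ Real.exp (1 + Y) := by
    rw [Real.exp_add]
    have := Real.one_le_exp hY0
    nlinarith [Real.add_one_le_exp (1 : ℝ), Real.exp_pos Y]
  have hd : ((d : ℝ) + 1) ≤ Real.exp d := Real.add_one_le_exp _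
  have hW0 := dominationConst_nonneg (Real.one_le_exp hm) hD0 d η
  calc _ ≤ Real.exp (3 * d) * Real.exp d ^ 4 * Real.exp m ^ (2 * d) * Real.exp (1 + Y) := by
        gcongr
        exact h8n d
    _ = Real.exp (zeroExponent m Λ d η) := by
        simp only [← Real.exp_nat_mul, ← Real.exp_add]
        congr 1
        rw [zeroExponent, ← hY]
        push_cast
        ring

theorem natCast_le_three_mul {n : ℕ} {V : ℝ} (h : (3 / 2 : ℝ) ^ n ≤ Real.exp V) : (n : ℝ) ≤ 3 * V := by
  -- From `log x ≥ 1 - 1/x` at `x = 3/2`; this gives the factor `3`.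
  have h1 : (1 / 3 : ℝ) ≤ Real.log (3 / 2) := by
    have := Real.one_sub_inv_le_log_of_pos (show (0 : ℝ) < 3 / 2 by norm_num)
    norm_num at this ⊢
    linarith
  have h2 := Real.log_le_log (by positivity) h
  rw [Real.log_pow, Real.log_exp] at h2
  nlinarith [(Nat.cast_nonneg n : (0 : ℝ) ≤ n)]

theorem zeroCount_le {g : ℂ → ℂ} {E : Set ℂ} {B : ℕ}
    (h : ∀ (s : Finset ℂ) (n : ℂ → ℕ), (s : Set ℂ) ⊆ E →
      (∀ b ∈ s, (n b : ℕ∞) ≤ analyticOrderAt g b) → ∑ b ∈ s, n b ≤ B) :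
    zeroCount g E ≤ B :=
  iSup_le fun s => iSup_le fun hs => sum_enat_le_of_forall_le s _ fun n hn => h s n hs hn

theorem exists_maxZeros_eq {m Λ D : ℝ} (hm : 0 ≤ m) (hΛ : 0 ≤ Λ) (hD0 : 0 ≤ D)
    (hDΛ : D ≤ Real.exp Λ) (hf : AnalyticOnNhd ℂ f (Metric.closedBall 0 1))
    (hfM : ∀ z ∈ Metric.closedBall (0 : ℂ) 1, ‖f z‖ ≤ Real.exp m)
    {η : ℕ} (hη : bautinMultiplicity f d = η)
    (hD : 1 ≤ D ^ (d * (d * (d + 1))) * ‖taylorCoeff (bautinDet f d) η 0‖) :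
    ∃ n : ℕ, maxZeros f (1 / 4) d = n ∧ (n : ℝ) ≤ 3 * zeroExponent m Λ d η := by
  have hV : 0 ≤ 3 * zeroExponent m Λ d η := by
    unfold zeroExponent
    positivity
  have hle : maxZeros f (1 / 4) d ≤ (⌊3 * zeroExponent m Λ d η⌋₊ : ℕ) := by
    refine iSup_le fun p => iSup_le fun hp0 => iSup_le fun hp => zeroCount_le fun s n hs hn => ?_
    refine Nat.le_floor (natCast_le_three_mul ?_)
    exact (pow_sum_le hf (Real.one_le_exp hm) hfM hp0 hp hη hD0 hD hs hn).trans
      (le_exp_zeroExponent hm hΛ hD0 hDΛ d η)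
  obtain ⟨n, hn⟩ := ENat.ne_top_iff_exists.1 (ne_top_of_le_ne_top (ENat.natCast_ne_top _) hle)
  refine ⟨n, hn.symm, ?_⟩
  rw [← hn] at hle
  exact (Nat.cast_le.2 (by exact_mod_cast hle)).trans (Nat.floor_le hV)

end Domination

/-! ### Polynomial growth in the degree -/

section PolyBounded

/-- `u` is bounded by a polynomial on the positive integers. -/
def PolyBounded (u : ℕ → ℝ) : Prop :=
  ∃ (C : ℝ) (k : ℕ), 0 ≤ C ∧ ∀ d : ℕ, 1 ≤ d → |u d| ≤ C * (d : ℝ) ^ k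

theorem PolyBounded.const (c : ℝ) : PolyBounded fun _ => c :=
  ⟨|c|, 0, abs_nonneg c, fun d _ => by simp⟩

theorem PolyBounded.natCast : PolyBounded fun d => (d : ℝ) :=
  ⟨1, 1, zero_le_one, fun d _ => by simp⟩

theorem PolyBounded.mul {u v : ℕ → ℝ} (hu : PolyBounded u) (hv : PolyBounded v) :
    PolyBounded fun d => u d * v d := by
  obtain ⟨C, k, hC, hu⟩ := hu
  obtain ⟨C', k', hC', hv⟩ := hv
  refine ⟨C * C', k + k', mul_nonneg hC hC', fun d hd => ?_⟩
  rw [abs_mul]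
  calc _ ≤ (C * (d : ℝ) ^ k) * (C' * (d : ℝ) ^ k') := by
        gcongr
        · exact hu d hd
        · exact hv d hd
    _ = _ := by ring

theorem PolyBounded.add {u v : ℕ → ℝ} (hu : PolyBounded u) (hv : PolyBounded v) :
    PolyBounded fun d => u d + v d := by
  obtain ⟨C, k, hC, hu⟩ := hu
  obtain ⟨C', k', hC', hv⟩ := hv
  refine ⟨C + C', k + k', add_nonneg hC hC', fun d hd => ?_⟩
  have hd1 : (1 : ℝ) ≤ d := by exact_mod_cast hd
  calc _ ≤ |u d| + |v d| := abs_add_le _ _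
    _ ≤ C * (d : ℝ) ^ k + C' * (d : ℝ) ^ k' := add_le_add (hu d hd) (hv d hd)
    _ ≤ C * (d : ℝ) ^ (k + k') + C' * (d : ℝ) ^ (k + k') := by
        gcongr <;> first | exact hd1 | omega
    _ = _ := by ring

theorem PolyBounded.pow {u : ℕ → ℝ} (hu : PolyBounded u) (n : ℕ) :
    PolyBounded fun d => u d ^ n := by
  induction n with
  | zero => simpa using PolyBounded.const 1
  | succ n ih => simpa only [pow_succ] using ih.mul hu

theorem PolyBounded.abs {u : ℕ → ℝ} (hu : PolyBounded u) : PolyBounded fun d => |u d| := by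
  obtain ⟨C, k, hC, hu⟩ := hu
  exact ⟨C, k, hC, fun d hd => by rw [abs_abs]; exact hu d hd⟩

theorem PolyBounded.mono {u v : ℕ → ℝ} (hv : PolyBounded v)
    (h : ∀ d : ℕ, 1 ≤ d → |u d| ≤ |v d|) : PolyBounded u := by
  obtain ⟨C, k, hC, hv⟩ := hv
  exact ⟨C, k, hC, fun d hd => (h d hd).trans (hv d hd)⟩

/-- `S` need not be monotone, so a bound on its argument cannot simply be substituted; bounds on
absolute values do survive composition. -/
theorem PolyBounded.eval {u : ℕ → ℝ} (hu : PolyBounded u) (P : Polynomial ℝ) :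
    PolyBounded fun d => P.eval (u d) := by
  induction P using Polynomial.induction_on' with
  | add P Q hP hQ => simpa only [Polynomial.eval_add] using hP.add hQ
  | monomial n c => simpa only [Polynomial.eval_monomial] using (PolyBounded.const c).mul (hu.pow n)

theorem PolyBounded.exists_polynomial {u : ℕ → ℝ} (hu : PolyBounded u) :
    ∃ T : Polynomial ℝ, ∀ d : ℕ, 1 ≤ d → u d ≤ T.eval (d : ℝ) := by
  obtain ⟨C, k, _, hu⟩ := hu
  refine ⟨Polynomial.C C * Polynomial.X ^ k, fun d hd => ?_⟩
  simpa using (le_abs_self _).trans (hu d hd)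

theorem PolyBounded.zeroExponent {m : ℝ} {Λ : ℕ → ℝ} {η : ℕ → ℕ} (hΛ : PolyBounded Λ)
    (hη : PolyBounded fun d => (η d : ℝ)) :
    PolyBounded fun d => zeroExponent m (Λ d) d (η d) := by
  have hd := PolyBounded.natCast
  have hd1 := hd.add (.const 1)
  have hL := (hd.pow 2).add ((PolyBounded.const 2).mul hd)
  have hK := hd.mul hd1
  exact ((((PolyBounded.const 7).mul hd).add (((PolyBounded.const 2).mul hd).mul (.const m))).add
    (.const 1)).add ((((((hd.mul hK).mul hΛ).add ((PolyBounded.const 3).mul hη)).add hK).add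
    (hK.pow 2)).add (hK.mul ((hd.mul (.const m)).add ((PolyBounded.const 3).mul hL))) |>.add
    ((PolyBounded.const 3).mul hL))

end PolyBounded

/-- The heights `h_l` ignore `a_0`, whose denominator is split off as a constant; the other `N`
denominators are each at most `h_N`. -/
theorem prod_den_le_exp {a : ℕ → ℚ} {S : Polynomial ℝ}
    (hS : ∀ l : ℕ, 1 ≤ l → (denomHeight a l : ℝ) ≤ Real.exp (S.eval (l : ℝ))) {N : ℕ}
    (hN : 1 ≤ N) :
    ((∏ k ∈ Finset.range (N + 1), (a k).den : ℕ) : ℝ) ≤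
      Real.exp ((a 0).den + N * |S.eval (N : ℝ)|) := by
  rw [Finset.prod_range_succ', mul_comm, Real.exp_add, Real.exp_nat_mul]
  push_cast
  gcongr
  · exact natCast_le_exp _
  · refine (Finset.prod_le_prod (g := fun _ => Real.exp |S.eval (N : ℝ)|)
      (fun _ _ => Nat.cast_nonneg _) fun k hk => ?_).trans_eq (by simp)
    have h1 : (a (k + 1)).den ≤ denomHeight a N :=
      Finset.le_sup (f := fun k => (a k).den)
        (Finset.mem_Icc.2 ⟨by omega, Finset.mem_range.1 hk⟩)
    exact (Nat.cast_le.2 h1).trans ((hS N hN).trans (Real.exp_le_exp.2 (le_abs_self _)))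

theorem exists_norm_le_exp {f : ℂ → ℂ} (hf : AnalyticOnNhd ℂ f (Metric.closedBall 0 1)) :
    ∃ m : ℝ, 0 ≤ m ∧ ∀ z ∈ Metric.closedBall (0 : ℂ) 1, ‖f z‖ ≤ Real.exp m := by
  obtain ⟨C, hC⟩ := (isCompact_closedBall (0 : ℂ) 1).exists_bound_of_continuousOn hf.continuousOn
  refine ⟨|C|, abs_nonneg C, fun z hz => (hC z hz).trans ?_⟩
  linarith [le_abs_self C, Real.add_one_le_exp |C|]

end BautinBezout
end

theorem mainTheorem2 (f : ℂ → ℂ)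
    (hf : AnalyticOnNhd ℂ f (Metric.closedBall 0 1))
    (a : ℕ → ℚ) (ha : ∀ k, BautinBezout.taylorCoeff f k 0 = (a k : ℂ))
    (S : Polynomial ℝ)
    (hS : ∀ l : ℕ, 1 ≤ l →
      (BautinBezout.denomHeight a l : ℝ) ≤ Real.exp (S.eval (l : ℝ)))
    (R : Polynomial ℝ)
    (hR : ∀ d : ℕ, 1 ≤ d →
      ∃ n : ℕ, BautinBezout.bautinMultiplicity f d = n ∧ (n : ℝ) ≤ R.eval (d : ℝ)) :
    (∀ d : ℕ, 1 ≤ d →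
      BautinBezout.transcendenceIndex f d ≤
        BautinBezout.bautinMultiplicity f d + ((d ^ 2 + 2 * d : ℕ) : ℕ∞)) ∧
    ∃ T : Polynomial ℝ, ∀ d : ℕ, 1 ≤ d →
      ∃ n : ℕ, BautinBezout.maxZeros f (1 / 4) d = n ∧ (n : ℝ) ≤ T.eval (d : ℝ) := by
  open BautinBezout in
  have hf0 : AnalyticAt ℂ f 0 := hf 0 (by simp)
  refine ⟨fun d _ => transcendenceIndex_le hf0 d, ?_⟩
  obtain ⟨m, hm, hfM⟩ := exists_norm_le_exp hf
  let η : ℕ → ℕ := fun d => (bautinMultiplicity f d).toNat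
  have hη : ∀ d, 1 ≤ d → bautinMultiplicity f d = η d ∧ (η d : ℝ) ≤ R.eval (d : ℝ) := by
    intro d hd
    obtain ⟨n, hn, hnR⟩ := hR d hd
    have h : η d = n := by simp [η, hn]
    rw [h]
    exact ⟨hn, hnR⟩
  -- Highest index of a Taylor coefficient of `f` entering the leading coefficient of `Δ_d`; `Λ d`
  -- bounds the logarithm of the common denominator up to it.
  let N : ℕ → ℕ := fun d => d ^ 2 + 2 * d + η d
  let Λ : ℕ → ℝ := fun d => (a 0).den + N d * |S.eval (N d : ℝ)|
  have hηP : PolyBounded fun d => (η d : ℝ) :=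
    (PolyBounded.natCast.eval R).mono fun d hd => by
      rw [Nat.abs_cast]
      exact (hη d hd).2.trans (le_abs_self _)
  have hNP : PolyBounded fun d => (N d : ℝ) := by
    have h := ((PolyBounded.natCast.pow 2).add ((PolyBounded.const 2).mul .natCast)).add hηP
    simpa [N] using h
  have hΛP : PolyBounded Λ :=
    (PolyBounded.const _).add (hNP.mul (hNP.eval S).abs)
  obtain ⟨T, hT⟩ := ((PolyBounded.const 3).mul
    (PolyBounded.zeroExponent (m := m) hΛP hηP)).exists_polynomial
  refine ⟨T, fun d hd => ?_⟩
  have hN : 1 ≤ N d := by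
    simp only [N]
    omega
  obtain ⟨n, hn, hle⟩ := exists_maxZeros_eq (Λ := Λ d) hm (by positivity) (Nat.cast_nonneg _)
    (prod_den_le_exp hS hN) hf hfM (hη d hd).1
    (one_le_norm_taylorCoeff_bautinDet hf0 ha (hη d hd).1)
  exact ⟨n, hn, hle.trans (hT d hd)⟩
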